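/- **Setting.** Let $M,N_c,N_s,T\ge 1$ and $K$ be integers. Consider the system $$Y_c=H_cX+Z_c,\qquad Y_s=H_sX+Z_s,\qquad H_s=g(\eta),$$ with waveform $X\in\mathbb C^{M\times T}$, random communication channel $H_c\in\mathbb C^{N_c\times M}$ with a given law, parameters $\eta\in\mathbb R^K$ with a given density $p_\eta$, injective $g:\mathbb R^K\to\mathbb C^{N_s\times M}$, and noise matrices $Z_c,Z_s$ with i.i.d. circularly symmetric complex Gaussian entries of variances $\sigma_c^2,\sigma_s^2>0$; $X$, $H_c$, $\eta$ and the noises are independent. The functions $g$ and $p_\eta$ are measurable and differentiable at $p_\eta$-almost every $\eta$, and the derivatives of $g$ and of $\ln p_\eta$ are square-integrable under $p_\eta$. An admissible strategy is a probability law $p_X$ of $X$ with $\mathbb E\,\mathrm{tr}(T^{-1}XX^{\mathrm H})=P_TM$, where $P_T>0$. Its rate is $R(p_X)=T^{-1}I(Y_c;X\mid H_c)\in[0,\infty]$, and its Cramér–Rao bound is $\epsilon(p_X)=\mathbb E_X[\mathrm{tr}\,J_{\eta|X}^{-1}]\in[0,\infty]$, where $$J_{\eta|X}=\mathbb E_{Y_s,\eta|X}\Big[\tfrac{\partial\ln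 p(Y_s|X,\eta)}{\partial\eta}\tfrac{\partial\ln p(Y_s|X,\eta)}{\partial\eta^{\mathrm T}}\Big]+\mathbb E_\eta\Big[\tfrac{\partial\ln p_\eta(\eta)}{\partial\eta}\tfrac{\partial\ln p_\eta(\eta)}{\partial\eta^{\mathrm T}}\Big]$$ and $\mathrm{tr}\,J^{-1}=+\infty$ if $J$ is singular. The CRB-rate region $\mathcal C\subseteq[0,\infty]^2$ is the set of pairs $(\epsilon,R)$ for which some admissible $p_X$ has $\epsilon(p_X)\le\epsilon$ and $R(p_X)\ge R$. Put $$\epsilon_{\min}=\min_{p_X}\epsilon(p_X),\quad R_{\max}=\max_{p_X}R(p_X),\quad \epsilon_1=\min_{R(p_X)=R_{\max}}\epsilon(p_X),\quad R_1=\max_{\epsilon(p_X)=\epsilon_{\min}}R(p_X),$$ and $P_{\rm SC}=(\epsilon_{\min},R_1)$, $P_{\rm CS}=(\epsilon_1,R_{\max})$. The convex hull of points of $[0,\infty]^2$ is the smallest set that contains them, is closed under convex combinations (with $0\cdot\infty=0$), and, if it has a point with first coordinate $+\infty$, contains with each point $(\epsilon,R)$ the ray $\{(e,R):\epsilon\le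 e\le+\infty\}$. **Proposition.** Suppose that the minima and maxima above are attained. Then the convex hull of $$(+\infty,0),\quad(+\infty,R_{\max}),\quad(\epsilon_{\min},0),\quad P_{\rm SC},\quad P_{\rm CS}$$ is contained in $\mathcal C$. In particular the segment between $P_{\rm SC}$ and $P_{\rm CS}$ is achieved by time-sharing: if $p_{\rm SC}$ and $p_{\rm CS}$ are strategies attaining $P_{\rm SC}$ and $P_{\rm CS}$, and $p,q\ge0$ with $p+q=1$, then the strategy that applies $p_{\rm SC}$ with probability $p$ and $p_{\rm CS}$ with probability $q$, that is, $p\,p_{\rm SC}+q\,p_{\rm CS}$, is admissible, has Cramér–Rao bound exactly $p\,\epsilon_{\min}+q\,\epsilon_1$ and rate at least $p\,R_1+q\,R_{\max}$; so $(p\,\epsilon_{\min}+q\,\epsilon_1,\;p\,R_1+q\,R_{\max})\in\mathcal C$. If attainment is not assumed, and the minima and maxima are replaced by infima and suprema in $[0,\infty]$ (with $\inf\emptyset=+\infty$ and $\sup\emptyset=0$), then the same convex hull is contained in the closure of $\mathcal C$ in $[0,\infty]^2$. -/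

import Mathlib

open MeasureTheory ProbabilityTheory Matrix InformationTheory
open scoped ENNReal NNReal

noncomputable section

/-- Complex matrices carry the product σ-algebra of their entries. -/
instance complexMatrixMeasurableSpace (m n : ℕ) :
    MeasurableSpace (Matrix (Fin m) (Fin n) ℂ) :=
  inferInstanceAs (MeasurableSpace (Fin m → Fin n → ℂ))

/-! ### Convex hulls in the extended quadrant -/

/-- A set of pairs `(ε, R)` in `[0, ∞] × [0, ∞]` is convex in the extended sense if it is closed
under convex combinations (in the arithmetic of `[0, ∞]`) and, whenever it has a point with first
coordinate `+∞`, it contains the horizontal ray `{(e, R) : ε ≤ e ≤ +∞}` from each of its points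
`(ε, R)`: this ray is the limit of the segments from `(ε, R)` to `(t, R')` as `t → +∞`. -/
def IsExtConvex (C : Set (ℝ≥0∞ × ℝ≥0∞)) : Prop :=
  Convex ℝ≥0 C ∧
    ∀ a ∈ C, ∀ b ∈ C, b.1 = ∞ → ∀ e : ℝ≥0∞, a.1 ≤ e → (e, a.2) ∈ C

/-- The convex hull of a set of points of `[0, ∞] × [0, ∞]`, some of which may have first
coordinate `+∞`: the smallest extended-convex set containing them. -/
def extConvexHull (S : Set (ℝ≥0∞ × ℝ≥0∞)) : Set (ℝ≥0∞ × ℝ≥0∞) :=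
  ⋂₀ {C | S ⊆ C ∧ IsExtConvex C}

/-! ### White complex Gaussian noise -/

/-- The circularly symmetric complex Gaussian law `CN(0, v)` on `ℂ`: independent real and
imaginary parts, each `N(0, v / 2)`. -/
def complexGaussian (v : ℝ≥0) : Measure ℂ :=
  ((gaussianReal 0 (v / 2)).prod (gaussianReal 0 (v / 2))).map
    Complex.measurableEquivRealProd.symm

/-- The density of `CN(0, v)` with respect to Lebesgue measure on `ℂ`. -/
def complexGaussianPDF (v : ℝ≥0) (z : ℂ) : ℝ :=
  gaussianPDFReal 0 (v / 2) z.re * gaussianPDFReal 0 (v / 2) z.im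

/-- The law of an `N × T` matrix with i.i.d. `CN(0, v)` entries. -/
def noiseLaw (N T : ℕ) (v : ℝ≥0) : Measure (Matrix (Fin N) (Fin T) ℂ) :=
  Measure.pi fun _ : Fin N => Measure.pi fun _ : Fin T => complexGaussian v

/-- The density of an `N × T` matrix with i.i.d. `CN(0, v)` entries. -/
def noisePDF {N T : ℕ} (v : ℝ≥0) (Z : Matrix (Fin N) (Fin T) ℂ) : ℝ :=
  ∏ i, ∏ j, complexGaussianPDF v (Z i j)

/-! ### The system model -/

/-- The data of an ISAC system `Y_c = H_c X + Z_c`, `Y_s = g(η) X + Z_s` with block length `T`. -/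
structure ISACModel (M Nc Ns T K : ℕ) where
  /-- the law of the communication channel matrix `H_c` -/
  channelLaw : Measure (Matrix (Fin Nc) (Fin M) ℂ)
  isProbabilityMeasure_channelLaw : IsProbabilityMeasure channelLaw
  /-- the variance `σ_c²` of the communication noise -/
  commVar : ℝ≥0
  commVar_pos : 0 < commVar
  /-- the variance `σ_s²` of the sensing noise -/
  sensVar : ℝ≥0
  sensVar_pos : 0 < sensVar
  /-- the power budget `P_T` -/
  power : ℝ
  power_pos : 0 < power
  /-- the dependence `H_s = g(η)` of the sensing channel on the sensing parameters -/
  g : EuclideanSpace ℝ (Fin K) → Matrix (Fin Ns) (Fin M) ℂ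
  g_injective : Function.Injective g
  g_measurable : Measurable g
  /-- the probability density `p_η` of the sensing parameters -/
  priorPDF : EuclideanSpace ℝ (Fin K) → ℝ
  priorPDF_measurable : Measurable priorPDF
  priorPDF_nonneg : ∀ η, 0 ≤ priorPDF η
  lintegral_priorPDF : ∫⁻ η, ENNReal.ofReal (priorPDF η) = 1
  /-- the derivatives in the Fisher information exist for almost every value of `η` ... -/
  g_differentiable :
    ∀ᵐ η ∂(volume.withDensity fun η => ENNReal.ofReal (priorPDF η)),
      ∀ i j, DifferentiableAt ℝ (fun η' => g η' i j) η
  priorPDF_differentiable :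
    ∀ᵐ η ∂(volume.withDensity fun η => ENNReal.ofReal (priorPDF η)),
      DifferentiableAt ℝ priorPDF η
  /-- ... and have finite second moments, so that the Fisher information is finite -/
  g_integrable : ∀ i j,
    Integrable (fun η => ‖fderiv ℝ (fun η' => g η' i j) η‖ ^ 2)
      (volume.withDensity fun η => ENNReal.ofReal (priorPDF η))
  priorPDF_integrable :
    Integrable (fun η => ‖fderiv ℝ (fun η' => Real.log (priorPDF η')) η‖ ^ 2)
      (volume.withDensity fun η => ENNReal.ofReal (priorPDF η))

namespace ISACModel

variable {M Nc Ns T K : ℕ} (S : ISACModel M Nc Ns T K)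

/-- The law of the sensing parameters `η`. -/
def prior : Measure (EuclideanSpace ℝ (Fin K)) :=
  volume.withDensity fun η => ENNReal.ofReal (S.priorPDF η)

/-! #### Transmission strategies -/

/-- The sample covariance matrix `R_X = T⁻¹ X Xᴴ`. -/
def sampleCov (X : Matrix (Fin M) (Fin T) ℂ) : Matrix (Fin M) (Fin M) ℂ :=
  (T : ℂ)⁻¹ • (X * Xᴴ)

/-- The admissible waveform distributions `p_X`: probability laws of the `M × T` waveform `X`
satisfying the power constraint `E tr R_X = P_T M`. -/
def inputLaws : Set (Measure (Matrix (Fin M) (Fin T) ℂ)) :=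
  {μ | IsProbabilityMeasure μ ∧ Integrable (fun X => (sampleCov X).trace.re) μ ∧
    ∫ X, (sampleCov X).trace.re ∂μ = S.power * M}

/-! #### Communication rate -/

/-- The joint law of `(X, Y_c)`, where `X ∼ μ` and `Y_c = H X + Z_c`, for a channel
realization `H`. -/
def jointLaw (H : Matrix (Fin Nc) (Fin M) ℂ) (μ : Measure (Matrix (Fin M) (Fin T) ℂ)) :
    Measure (Matrix (Fin M) (Fin T) ℂ × Matrix (Fin Nc) (Fin T) ℂ) :=
  (μ.prod (noiseLaw Nc T S.commVar)).map fun w => (w.1, H * w.1 + w.2)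

/-- The conditional mutual information (in nats) of `X` and `Y_c` given `H_c`: the average over
`H_c` of the Kullback-Leibler divergence between the joint law of `(X, Y_c)` and the product of
its marginals. -/
def mutualInfo (μ : Measure (Matrix (Fin M) (Fin T) ℂ)) : ℝ≥0∞ :=
  ∫⁻ H, klDiv (S.jointLaw H μ) ((S.jointLaw H μ).fst.prod (S.jointLaw H μ).snd) ∂S.channelLaw

/-- The ergodic rate `T⁻¹ I(Y_c; X | H_c)`. -/
def rate (μ : Measure (Matrix (Fin M) (Fin T) ℂ)) : ℝ≥0∞ :=
  (T : ℝ≥0∞)⁻¹ * S.mutualInfo μ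

/-! #### Sensing accuracy -/

/-- The partial derivative `∂f/∂η_i` at `η`. -/
def partialDeriv (f : EuclideanSpace ℝ (Fin K) → ℝ) (i : Fin K)
    (η : EuclideanSpace ℝ (Fin K)) : ℝ :=
  fderiv ℝ f η (EuclideanSpace.single i 1)

/-- The logarithm of the density of `Y_s` given `X` and `η`. -/
def logLikelihood (X : Matrix (Fin M) (Fin T) ℂ) (Y : Matrix (Fin Ns) (Fin T) ℂ)
    (η : EuclideanSpace ℝ (Fin K)) : ℝ :=
  Real.log (noisePDF S.sensVar (Y - S.g η * X))

/-- The Bayesian Fisher information matrix of `η` given the waveform `X`. In the first integral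
`w = (η, Z_s)`, so that `Y_s = g(η) X + Z_s`. -/
def bfim (X : Matrix (Fin M) (Fin T) ℂ) : Matrix (Fin K) (Fin K) ℝ :=
  Matrix.of fun i j =>
    (∫ w, partialDeriv (S.logLikelihood X (S.g w.1 * X + w.2)) i w.1 *
        partialDeriv (S.logLikelihood X (S.g w.1 * X + w.2)) j w.1
      ∂(S.prior.prod (noiseLaw Ns T S.sensVar))) +
    ∫ η, partialDeriv (fun η' => Real.log (S.priorPDF η')) i η *
      partialDeriv (fun η' => Real.log (S.priorPDF η')) j η ∂S.prior

open Classical in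
/-- The conditional Cramér-Rao bound `tr J⁻¹` for the waveform `X`; it is `+∞` if the Fisher
information matrix `J` is singular. -/
def condCRB (X : Matrix (Fin M) (Fin T) ℂ) : ℝ≥0∞ :=
  if IsUnit (S.bfim X).det then ENNReal.ofReal (S.bfim X)⁻¹.trace else ∞

/-- The Cramér-Rao bound `ε_η = E_X tr J⁻¹` of a waveform distribution. -/
def crb (μ : Measure (Matrix (Fin M) (Fin T) ℂ)) : ℝ≥0∞ :=
  ∫⁻ X, S.condCRB X ∂μ

/-! #### The CRB-rate region and its extreme points -/

/-- The CRB-rate region: all pairs `(ε, R)` such that some admissible waveform distribution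
has Cramér-Rao bound at most `ε` and supports the rate `R`. -/
def region : Set (ℝ≥0∞ × ℝ≥0∞) :=
  {q | ∃ μ ∈ S.inputLaws, S.crb μ ≤ q.1 ∧ q.2 ≤ S.rate μ}

/-- `ε_min`, the optimal value of the Cramér-Rao bound. -/
def epsMin : ℝ≥0∞ := ⨅ μ ∈ S.inputLaws, S.crb μ

/-- `R_max`, the optimal value of the rate. -/
def rateMax : ℝ≥0∞ := ⨆ μ ∈ S.inputLaws, S.rate μ

/-- `ε_1`, the optimal value of the Cramér-Rao bound under the constraint that the rate is
`R_max` (`+∞` if the constraint cannot be met). -/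
def epsOne : ℝ≥0∞ := ⨅ μ ∈ {μ ∈ S.inputLaws | S.rate μ = S.rateMax}, S.crb μ

/-- `R_1`, the optimal value of the rate under the constraint that the Cramér-Rao bound is
`ε_min` (`0` if the constraint cannot be met). -/
def rateOne : ℝ≥0∞ := ⨆ μ ∈ {μ ∈ S.inputLaws | S.crb μ = S.epsMin}, S.rate μ

/-- The pentagon: the convex hull of `(+∞, 0)`, `(+∞, R_max)`, `(ε_min, 0)`,
`P_SC = (ε_min, R_1)` and `P_CS = (ε_1, R_max)`. -/
def pentagon : Set (ℝ≥0∞ × ℝ≥0∞) :=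
  extConvexHull {(∞, 0), (∞, S.rateMax), (S.epsMin, 0), (S.epsMin, S.rateOne),
    (S.epsOne, S.rateMax)}

/-- The waveform distribution `μ` attains `P_SC`: it attains the minimum `ε_min`, and among the
distributions that do so it attains the maximum `R_1` of the rate. -/
def AttainsSC (μ : Measure (Matrix (Fin M) (Fin T) ℂ)) : Prop :=
  μ ∈ S.inputLaws ∧ S.crb μ = S.epsMin ∧ S.rate μ = S.rateOne

/-- The waveform distribution `μ` attains `P_CS`: it attains the maximum `R_max`, and among the
distributions that do so it attains the minimum `ε_1` of the Cramér-Rao bound. -/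
def AttainsCS (μ : Measure (Matrix (Fin M) (Fin T) ℂ)) : Prop :=
  μ ∈ S.inputLaws ∧ S.rate μ = S.rateMax ∧ S.crb μ = S.epsOne

end ISACModel

end

/-!
Time-sharing makes the CRB-rate region convex. The Cramér-Rao bound is an integral against the input
law, hence affine in it, and the power constraint is preserved by mixing. The rate is concave in the
input law: for a channel `κ`, an input law `μ = p μ₁ + q μ₂` and its output law `ν`, if
`μ ⊗ₘ κ ≪ μ.prod ν` then a single density `φ` of `μ ⊗ₘ κ` with respect to `μ.prod ν` is also a
density of each `μᵢ ⊗ₘ κ` with respect to `μᵢ.prod ν` (`klDiv_compProd_prod_of_ac`), so that the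
mutual information of `μ` is the average with weights `p`, `q` of the divergences of `μᵢ ⊗ₘ κ` from
`μᵢ.prod ν`. Replacing `ν` by the true output law of `μᵢ` only lowers these divergences
(`klDiv_prod_snd_le`), by the chain rule. If `μ ⊗ₘ κ` is not absolutely continuous, the mutual
information of `μ` is infinite and nothing is to be shown.

The region is also closed under increasing the first coordinate, and both properties pass to its
closure (`isExtConvex_closure`). Hence the pentagon lies in the region, or in its closure, as soon
as its five vertices do. Optimal values that are attained give points of the region; infima and
suprema over nonempty sets give points of the closure; and over an empty set the conventions
`⨅ = ∞` and `⨆ = 0` reduce the vertex to one of the others.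
-/

/-! ### Concavity of mutual information in the input law -/

section MutualInformation

variable {𝓧 𝓨 : Type*} [MeasurableSpace 𝓧] [MeasurableSpace 𝓨]

theorem klDiv_map_measurableEquiv (e : 𝓧 ≃ᵐ 𝓨) (μ ν : Measure 𝓧) [IsFiniteMeasure μ]
    [IsFiniteMeasure ν] : klDiv (μ.map e) (ν.map e) = klDiv μ ν := by
  refine le_antisymm (klDiv_map_le μ ν e.measurable) ?_
  simpa [Measure.map_map e.symm.measurable e.measurable] using
    klDiv_map_le (μ.map e) (ν.map e) e.symm.measurable

/-- Among all product measures with a given first factor, the one whose second factor is the second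
marginal of `ρ` is closest to `ρ`: by the chain rule, replacing that marginal by `ν` adds
`klDiv ρ.snd ν` to the divergence. -/
theorem klDiv_prod_snd_le [StandardBorelSpace 𝓧] [Nonempty 𝓧] (ρ : Measure (𝓧 × 𝓨))
    [IsFiniteMeasure ρ] (μ : Measure 𝓧) [IsProbabilityMeasure μ] (ν : Measure 𝓨)
    [IsFiniteMeasure ν] : klDiv ρ (μ.prod ρ.snd) ≤ klDiv ρ (μ.prod ν) := by
  have swap (τ : Measure 𝓨) [IsFiniteMeasure τ] :
      klDiv ρ (μ.prod τ) = klDiv (ρ.snd ⊗ₘ (ρ.map Prod.swap).condKernel)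
        (τ ⊗ₘ Kernel.const 𝓨 μ) := by
    have hρ : ρ.snd ⊗ₘ (ρ.map Prod.swap).condKernel = ρ.map Prod.swap := by
      rw [← Measure.fst_map_swap]
      exact (ρ.map Prod.swap).disintegrate _
    rw [hρ, Measure.compProd_const, ← Measure.prod_swap (μ := μ)]
    exact (klDiv_map_measurableEquiv MeasurableEquiv.prodComm ρ (μ.prod τ)).symm
  rw [swap, swap, klDiv_compProd_eq_add _ ν]
  exact le_add_self

theorem withDensity_compProd_left (μ : Measure 𝓧) [SFinite μ] (κ : Kernel 𝓧 𝓨)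
    [IsSFiniteKernel κ] {h : 𝓧 → ℝ≥0∞} (hh : Measurable h) :
    μ.withDensity h ⊗ₘ κ = (μ ⊗ₘ κ).withDensity fun z => h z.1 := by
  ext s hs
  rw [Measure.compProd_apply hs, withDensity_apply _ hs, ← lintegral_indicator hs,
    Measure.lintegral_compProd (f := s.indicator fun z => h z.1)
      ((hh.comp measurable_fst).indicator hs),
    lintegral_withDensity_eq_lintegral_mul _ hh (Kernel.measurable_kernel_prodMk_left hs)]
  refine lintegral_congr fun x => ?_
  exact (lintegral_indicator_const (measurable_prodMk_left hs) (h x)).symm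

/-- Weighting two measures by the same density does not change their relative density. -/
theorem klDiv_withDensity {ρ σ : Measure 𝓧} [IsFiniteMeasure ρ] [IsFiniteMeasure σ] (hρσ : ρ ≪ σ)
    {h : 𝓧 → ℝ≥0∞} (hh : Measurable h) [IsFiniteMeasure (ρ.withDensity h)]
    [IsFiniteMeasure (σ.withDensity h)] :
    klDiv (ρ.withDensity h) (σ.withDensity h) =
      ∫⁻ x, ENNReal.ofReal (klFun (ρ.rnDeriv σ x).toReal) ∂σ.withDensity h := by
  have key : ρ.withDensity h = (σ.withDensity h).withDensity (ρ.rnDeriv σ) := by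
    conv_lhs => rw [← Measure.withDensity_rnDeriv_eq ρ σ hρσ]
    rw [← withDensity_mul _ (Measure.measurable_rnDeriv ρ σ) hh, mul_comm,
      withDensity_mul _ hh (Measure.measurable_rnDeriv ρ σ)]
  have hac : ρ.withDensity h ≪ σ.withDensity h := by
    rw [key]
    exact withDensity_absolutelyContinuous _ _
  rw [klDiv_eq_lintegral_klFun_of_ac hac]
  refine lintegral_congr_ae ?_
  rw [key]
  filter_upwards [Measure.rnDeriv_withDensity (σ.withDensity h)
    (Measure.measurable_rnDeriv ρ σ)] with x hx
  rw [hx]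

/-- The density of `μ ⊗ₘ κ` with respect to `μ.prod ν` is the density of `κ x` with respect to `ν`,
so it also serves for every input law absolutely continuous with respect to `μ`. -/
theorem klDiv_compProd_prod_of_ac {μ μ' : Measure 𝓧} [IsFiniteMeasure μ] [IsFiniteMeasure μ']
    (hμ : μ' ≪ μ) (κ : Kernel 𝓧 𝓨) [IsMarkovKernel κ] (ν : Measure 𝓨) [IsFiniteMeasure ν]
    (hac : μ ⊗ₘ κ ≪ μ.prod ν) :
    klDiv (μ' ⊗ₘ κ) (μ'.prod ν) =
      ∫⁻ z, ENNReal.ofReal (klFun ((μ ⊗ₘ κ).rnDeriv (μ.prod ν) z).toReal) ∂μ'.prod ν := by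
  have h1 : μ' ⊗ₘ κ = (μ ⊗ₘ κ).withDensity fun z => μ'.rnDeriv μ z.1 := by
    rw [← withDensity_compProd_left _ _ (Measure.measurable_rnDeriv μ' μ),
      Measure.withDensity_rnDeriv_eq _ _ hμ]
  have h2 : μ'.prod ν = (μ.prod ν).withDensity fun z => μ'.rnDeriv μ z.1 := by
    rw [← Measure.compProd_const, ← Measure.compProd_const,
      ← withDensity_compProd_left _ _ (Measure.measurable_rnDeriv μ' μ),
      Measure.withDensity_rnDeriv_eq _ _ hμ]
  have : IsFiniteMeasure ((μ ⊗ₘ κ).withDensity fun z => μ'.rnDeriv μ z.1) := h1 ▸ inferInstance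
  have : IsFiniteMeasure ((μ.prod ν).withDensity fun z => μ'.rnDeriv μ z.1) := h2 ▸ inferInstance
  rw [h1, h2]
  exact klDiv_withDensity hac ((Measure.measurable_rnDeriv μ' μ).comp measurable_fst)

/-- The mutual information between the input and the output of a channel `κ` is a concave function
of the input law. -/
theorem concave_klDiv_compProd [StandardBorelSpace 𝓧] [Nonempty 𝓧] (μ₁ μ₂ : Measure 𝓧)
    [IsProbabilityMeasure μ₁] [IsProbabilityMeasure μ₂] (κ : Kernel 𝓧 𝓨) [IsMarkovKernel κ]
    (p q : ℝ≥0) :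
    p * klDiv (μ₁ ⊗ₘ κ) (μ₁.prod (μ₁ ⊗ₘ κ).snd) + q * klDiv (μ₂ ⊗ₘ κ) (μ₂.prod (μ₂ ⊗ₘ κ).snd) ≤
      klDiv ((p • μ₁ + q • μ₂) ⊗ₘ κ)
        ((p • μ₁ + q • μ₂).prod ((p • μ₁ + q • μ₂) ⊗ₘ κ).snd) := by
  set μ := p • μ₁ + q • μ₂ with hμ
  set ν := (μ ⊗ₘ κ).snd with hν
  by_cases hac : μ ⊗ₘ κ ≪ μ.prod ν
  swap
  · simp [klDiv_of_not_ac hac]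
  set φ : 𝓧 × 𝓨 → ℝ≥0∞ :=
    fun z => ENNReal.ofReal (klFun ((μ ⊗ₘ κ).rnDeriv (μ.prod ν) z).toReal)
  have bound (r : ℝ≥0) (μ' : Measure 𝓧) [IsProbabilityMeasure μ'] (hr : r ≠ 0 → μ' ≪ μ) :
      r * klDiv (μ' ⊗ₘ κ) (μ'.prod (μ' ⊗ₘ κ).snd) ≤ r * ∫⁻ z, φ z ∂μ'.prod ν := by
    rcases eq_or_ne r 0 with rfl | h0
    · simp
    gcongr
    rw [← klDiv_compProd_prod_of_ac (hr h0) κ ν hac]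
    exact klDiv_prod_snd_le _ _ _
  have ac {r : ℝ≥0} (h0 : r ≠ 0) (μ' : Measure 𝓧) : μ' ≪ r • μ' :=
    Measure.absolutelyContinuous_smul (c := (r : ℝ≥0∞)) (by simpa using h0)
  calc _ ≤ p * ∫⁻ z, φ z ∂μ₁.prod ν + q * ∫⁻ z, φ z ∂μ₂.prod ν :=
        add_le_add
          (bound p μ₁ fun h => (ac h μ₁).trans (Measure.le_add_right le_rfl).absolutelyContinuous)
          (bound q μ₂ fun h => (ac h μ₂).trans (Measure.le_add_left le_rfl).absolutelyContinuous)
    _ = ∫⁻ z, φ z ∂μ.prod ν := by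
        have : μ.prod ν = (p : ℝ≥0∞) • μ₁.prod ν + (q : ℝ≥0∞) • μ₂.prod ν := by
          rw [← Measure.prod_smul_left, ← Measure.prod_smul_left, ← Measure.add_prod]
          rfl
        rw [this, lintegral_add_measure, lintegral_smul_measure, lintegral_smul_measure]
        rfl
    _ = _ := (klDiv_compProd_prod_of_ac Measure.AbsolutelyContinuous.rfl κ ν hac).symm

end MutualInformation

/-! ### Convexity in the extended quadrant -/

/-- The closure of a convex set of the extended quadrant that is closed under increasing the first
coordinate is convex in the extended sense. -/
theorem isExtConvex_closure {C : Set (ℝ≥0∞ × ℝ≥0∞)} (hC : Convex ℝ≥0 C)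
    (hup : ∀ a ∈ C, ∀ e, a.1 ≤ e → (e, a.2) ∈ C) : IsExtConvex (closure C) := by
  constructor
  · intro x hx y hy a b ha hb hab
    have hcont : Continuous fun z : (ℝ≥0∞ × ℝ≥0∞) × (ℝ≥0∞ × ℝ≥0∞) => a • z.1 + b • z.2 := by
      have key (c : ℝ≥0) : Continuous fun t : ℝ≥0∞ => c • t :=
        ENNReal.continuous_const_mul ENNReal.coe_ne_top
      have (c : ℝ≥0) : Continuous fun t : ℝ≥0∞ × ℝ≥0∞ => c • t :=
        ((key c).comp continuous_fst).prodMk ((key c).comp continuous_snd)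
      exact ((this a).comp continuous_fst).add ((this b).comp continuous_snd)
    exact map_mem_closure₂ (f := fun x y => a • x + b • y) hcont hx hy
      fun x hx y hy => hC hx hy ha hb hab
  · intro a ha _ _ _ e he
    have hcont : Continuous fun z : ℝ≥0∞ × ℝ≥0∞ => (max z.1 e, z.2) := by fun_prop
    have := map_mem_closure hcont ha fun z hz => hup z hz _ (le_max_left z.1 e)
    simpa [max_eq_right he] using this

theorem extConvexHull_subset {S C : Set (ℝ≥0∞ × ℝ≥0∞)} (hS : S ⊆ C) (hC : IsExtConvex C) :
    extConvexHull S ⊆ C :=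
  Set.sInter_subset_of_mem ⟨hS, hC⟩

/-! ### The communication channel as a Markov kernel -/

instance complexMatrixStandardBorelSpace (m n : ℕ) :
    StandardBorelSpace (Matrix (Fin m) (Fin n) ℂ) :=
  inferInstanceAs (StandardBorelSpace (Fin m → Fin n → ℂ))

theorem measurable_mul_add {m n k : ℕ} (H : Matrix (Fin n) (Fin m) ℂ) :
    Measurable fun w : Matrix (Fin m) (Fin k) ℂ × Matrix (Fin n) (Fin k) ℂ => H * w.1 + w.2 := by
  have entry {a b : ℕ} (i : Fin a) (j : Fin b) :
      Measurable fun A : Matrix (Fin a) (Fin b) ℂ => A i j :=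
    (measurable_pi_apply j).comp (measurable_pi_apply (X := fun _ : Fin a => Fin b → ℂ) i)
  refine measurable_pi_lambda _ fun i => measurable_pi_lambda _ fun j => ?_
  simp only [Matrix.add_apply, Matrix.mul_apply]
  have h1 (l : Fin m) : Measurable
      fun w : Matrix (Fin m) (Fin k) ℂ × Matrix (Fin n) (Fin k) ℂ => w.1 l j :=
    (entry l j).comp measurable_fst
  have h2 : Measurable
      fun w : Matrix (Fin m) (Fin k) ℂ × Matrix (Fin n) (Fin k) ℂ => w.2 i j :=
    (entry i j).comp measurable_snd
  fun_prop

instance isProbabilityMeasure_complexGaussian (v : ℝ≥0) :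
    IsProbabilityMeasure (complexGaussian v) :=
  Measure.isProbabilityMeasure_map Complex.measurableEquivRealProd.symm.measurable.aemeasurable

instance isProbabilityMeasure_noiseLaw (N T : ℕ) (v : ℝ≥0) :
    IsProbabilityMeasure (noiseLaw N T v) :=
  inferInstanceAs (IsProbabilityMeasure
    (Measure.pi fun _ : Fin N => Measure.pi fun _ : Fin T => complexGaussian v))

namespace ISACModel

variable {M Nc Ns T K : ℕ} (S : ISACModel M Nc Ns T K)

/-- The communication channel for the channel realization `H`: given the waveform `X`, the output
has the law of `H * X + Z_c`. -/
noncomputable def channel (H : Matrix (Fin Nc) (Fin M) ℂ) :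
    Kernel (Matrix (Fin M) (Fin T) ℂ) (Matrix (Fin Nc) (Fin T) ℂ) :=
  (Kernel.id ×ₖ Kernel.const _ (noiseLaw Nc T S.commVar)).map fun w => H * w.1 + w.2

instance (H : Matrix (Fin Nc) (Fin M) ℂ) : IsMarkovKernel (S.channel H) :=
  Kernel.IsMarkovKernel.map _ (measurable_mul_add H)

theorem jointLaw_eq_compProd (H : Matrix (Fin Nc) (Fin M) ℂ)
    (μ : Measure (Matrix (Fin M) (Fin T) ℂ)) [SFinite μ] :
    S.jointLaw H μ = μ ⊗ₘ S.channel H := by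
  have hm := measurable_mul_add (k := T) H
  ext s hs
  rw [jointLaw, Measure.map_apply (measurable_fst.prodMk hm) hs,
    Measure.prod_apply (measurable_fst.prodMk hm hs), Measure.compProd_apply hs]
  refine lintegral_congr fun X => ?_
  rw [channel, Kernel.map_apply' _ hm _ (measurable_prodMk_left hs), Kernel.prod_apply,
    Kernel.id_apply, Kernel.const_apply, Measure.dirac_prod,
    Measure.map_apply measurable_prodMk_left (hm (measurable_prodMk_left hs))]
  rfl

/-! ### Time-sharing -/

theorem mutualInfo_concave (μ₁ μ₂ : Measure (Matrix (Fin M) (Fin T) ℂ)) [IsProbabilityMeasure μ₁]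
    [IsProbabilityMeasure μ₂] (p q : ℝ≥0) :
    p * S.mutualInfo μ₁ + q * S.mutualInfo μ₂ ≤ S.mutualInfo (p • μ₁ + q • μ₂) := by
  unfold mutualInfo
  -- The bounds on the lower integral used here do not need measurability in the channel matrix.
  refine (add_le_add (lintegral_const_mul_le _ _) (lintegral_const_mul_le _ _)).trans
    ((le_lintegral_add _ _).trans (lintegral_mono fun H => ?_))
  simp only [jointLaw_eq_compProd, Measure.fst_compProd]
  exact concave_klDiv_compProd μ₁ μ₂ (S.channel H) p q

theorem rate_concave (μ₁ μ₂ : Measure (Matrix (Fin M) (Fin T) ℂ)) [IsProbabilityMeasure μ₁]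
    [IsProbabilityMeasure μ₂] (p q : ℝ≥0) :
    p * S.rate μ₁ + q * S.rate μ₂ ≤ S.rate (p • μ₁ + q • μ₂) := by
  unfold rate
  rw [mul_left_comm, mul_left_comm (q : ℝ≥0∞), ← mul_add]
  gcongr
  exact S.mutualInfo_concave μ₁ μ₂ p q

theorem crb_mix (μ₁ μ₂ : Measure (Matrix (Fin M) (Fin T) ℂ)) (p q : ℝ≥0) :
    S.crb (p • μ₁ + q • μ₂) = p * S.crb μ₁ + q * S.crb μ₂ := by
  simp only [crb, lintegral_add_measure]
  exact congrArg₂ _ (lintegral_smul_measure (p : ℝ≥0∞) _) (lintegral_smul_measure (q : ℝ≥0∞) _)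

theorem mix_mem_inputLaws {μ₁ μ₂ : Measure (Matrix (Fin M) (Fin T) ℂ)} (h₁ : μ₁ ∈ S.inputLaws)
    (h₂ : μ₂ ∈ S.inputLaws) {p q : ℝ≥0} (hpq : p + q = 1) : p • μ₁ + q • μ₂ ∈ S.inputLaws := by
  obtain ⟨_, i₁, e₁⟩ := h₁
  obtain ⟨_, i₂, e₂⟩ := h₂
  have j₁ := i₁.smul_measure_nnreal (c := p)
  have j₂ := i₂.smul_measure_nnreal (c := q)
  refine ⟨⟨?_⟩, j₁.add_measure j₂, ?_⟩
  · simp only [Measure.add_apply, Measure.smul_apply, measure_univ]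
    simp only [ENNReal.smul_def, smul_eq_mul, mul_one]
    exact_mod_cast hpq
  · rw [integral_add_measure j₁ j₂, integral_smul_nnreal_measure, integral_smul_nnreal_measure,
      e₁, e₂, ← add_smul, hpq, one_smul]

/-- A constant waveform of the right power is an admissible strategy. -/
theorem inputLaws_nonempty (hT : 0 < T) : S.inputLaws.Nonempty := by
  let X : Matrix (Fin M) (Fin T) ℂ := Matrix.of fun _ _ => (√S.power : ℂ)
  have hX : (sampleCov X).trace.re = S.power * M := by
    have hT' : (T : ℂ) ≠ 0 := by exact_mod_cast hT.ne'
    have hs : (√S.power : ℂ) * √S.power = S.power := by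
      exact_mod_cast Real.mul_self_sqrt S.power_pos.le
    have : (sampleCov X).trace = S.power * M := by
      simp [sampleCov, Matrix.trace, Matrix.mul_apply, X, hs]
      field_simp
    rw [this]
    simp
  refine ⟨Measure.dirac X, inferInstance, ?_, ?_⟩
  · exact integrable_dirac (by simp)
  · rw [integral_dirac, hX]

theorem convex_region : Convex ℝ≥0 S.region := by
  rintro x ⟨μ₁, h₁, c₁, r₁⟩ y ⟨μ₂, h₂, c₂, r₂⟩ a b - - hab
  have := h₁.1
  have := h₂.1
  refine ⟨a • μ₁ + b • μ₂, S.mix_mem_inputLaws h₁ h₂ hab, ?_,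
    le_trans ?_ (S.rate_concave μ₁ μ₂ a b)⟩
  · rw [crb_mix]
    exact add_le_add (mul_le_mul_right c₁ _) (mul_le_mul_right c₂ _)
  · exact add_le_add (mul_le_mul_right r₁ _) (mul_le_mul_right r₂ _)

theorem mem_region_of_fst_le {a : ℝ≥0∞ × ℝ≥0∞} (ha : a ∈ S.region) {e : ℝ≥0∞} (he : a.1 ≤ e) :
    (e, a.2) ∈ S.region :=
  let ⟨μ, h, c, r⟩ := ha
  ⟨μ, h, c.trans he, r⟩

theorem isExtConvex_region : IsExtConvex S.region :=
  ⟨S.convex_region, fun _ ha _ _ _ _ he => S.mem_region_of_fst_le ha he⟩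

/-! ### The pentagon -/

/-- Over a nonempty set of strategies, the infimum of the Cramér-Rao bounds is approached by points
of the region. -/
theorem iInf_crb_mem_closure {A : Set (Measure (Matrix (Fin M) (Fin T) ℂ))} (hA : A.Nonempty)
    (hAS : A ⊆ S.inputLaws) {r : ℝ≥0∞} (hr : ∀ μ ∈ A, r ≤ S.rate μ) :
    (⨅ μ ∈ A, S.crb μ, r) ∈ closure S.region := by
  rw [← sInf_image]
  exact map_mem_closure (f := fun t : ℝ≥0∞ => (t, r)) (by fun_prop)
    (sInf_mem_closure (hA.image S.crb))
    (by rintro _ ⟨μ, h, rfl⟩; exact ⟨μ, hAS h, le_rfl, hr μ h⟩)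

/-- Over a nonempty set of strategies, the supremum of the rates is approached by points of the
region. -/
theorem iSup_rate_mem_closure {A : Set (Measure (Matrix (Fin M) (Fin T) ℂ))} (hA : A.Nonempty)
    (hAS : A ⊆ S.inputLaws) {e : ℝ≥0∞} (he : ∀ μ ∈ A, S.crb μ ≤ e) :
    (e, ⨆ μ ∈ A, S.rate μ) ∈ closure S.region := by
  rw [← sSup_image]
  exact map_mem_closure (f := fun t : ℝ≥0∞ => (e, t)) (by fun_prop)
    (sSup_mem_closure (hA.image S.rate))
    (by rintro _ ⟨μ, h, rfl⟩; exact ⟨μ, hAS h, he μ h, le_rfl⟩)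

theorem pentagon_subset_closure_region (hT : 0 < T) : S.pentagon ⊆ closure S.region := by
  have hne := S.inputLaws_nonempty hT
  have hmax : (∞, S.rateMax) ∈ closure S.region :=
    S.iSup_rate_mem_closure hne subset_rfl fun _ _ => le_top
  have hmin : (S.epsMin, 0) ∈ closure S.region :=
    S.iInf_crb_mem_closure hne subset_rfl fun _ _ => zero_le
  refine extConvexHull_subset ?_
    (isExtConvex_closure S.convex_region fun _ ha _ => S.mem_region_of_fst_le ha)
  rintro _ (rfl | rfl | rfl | rfl | rfl)
  · obtain ⟨μ, h⟩ := hne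
    exact subset_closure ⟨μ, h, le_top, zero_le⟩
  · exact hmax
  · exact hmin
  · rcases Set.eq_empty_or_nonempty {μ ∈ S.inputLaws | S.crb μ = S.epsMin} with h | h
    · -- The supremum over the empty set is `0`.
      simpa [rateOne, h] using hmin
    · exact S.iSup_rate_mem_closure h (Set.sep_subset _ _) fun μ hμ => hμ.2.le
  · rcases Set.eq_empty_or_nonempty {μ ∈ S.inputLaws | S.rate μ = S.rateMax} with h | h
    · -- The infimum over the empty set is `∞`.
      simpa [epsOne, h] using hmax
    · exact S.iInf_crb_mem_closure h (Set.sep_subset _ _) fun μ hμ => hμ.2.ge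

theorem pentagon_subset_region {μSC μCS : Measure (Matrix (Fin M) (Fin T) ℂ)}
    (hSC : S.AttainsSC μSC) (hCS : S.AttainsCS μCS) : S.pentagon ⊆ S.region := by
  obtain ⟨h, c, r⟩ := hSC
  obtain ⟨h', r', c'⟩ := hCS
  refine extConvexHull_subset ?_ S.isExtConvex_region
  rintro _ (rfl | rfl | rfl | rfl | rfl)
  · exact ⟨μSC, h, le_top, zero_le⟩
  · exact ⟨μCS, h', le_top, r'.ge⟩
  · exact ⟨μSC, h, c.le, zero_le⟩
  · exact ⟨μSC, h, c.le, r.ge⟩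
  · exact ⟨μCS, h', c'.le, r'.ge⟩

end ISACModel

theorem proposition1 {M Nc Ns T K : ℕ} (hT : 0 < T) (S : ISACModel M Nc Ns T K) :
    -- the optimal values may be mere infima and suprema: inner bound up to closure
    S.pentagon ⊆ closure S.region ∧
    -- the optimal values are attained minima and maxima: exact inner bound and time-sharing
    ∀ μSC μCS : Measure (Matrix (Fin M) (Fin T) ℂ), S.AttainsSC μSC → S.AttainsCS μCS →
      S.pentagon ⊆ S.region ∧
      ∀ p q : ℝ≥0, p + q = 1 →
        p • μSC + q • μCS ∈ S.inputLaws ∧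
        S.crb (p • μSC + q • μCS) = p * S.epsMin + q * S.epsOne ∧
        p * S.rateOne + q * S.rateMax ≤ S.rate (p • μSC + q • μCS) ∧
        ((p : ℝ≥0∞) * S.epsMin + q * S.epsOne, p * S.rateOne + q * S.rateMax) ∈ S.region := by
  refine ⟨S.pentagon_subset_closure_region hT, fun μSC μCS hSC hCS =>
    ⟨S.pentagon_subset_region hSC hCS, fun p q hpq => ?_⟩⟩
  obtain ⟨h, c, r⟩ := hSC
  obtain ⟨h', r', c'⟩ := hCS
  have := h.1
  have := h'.1
  have hmem := S.mix_mem_inputLaws h h' hpq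
  have hcrb := S.crb_mix μSC μCS p q
  have hrate := S.rate_concave μSC μCS p q
  rw [c, c'] at hcrb
  rw [r, r'] at hrate
  exact ⟨hmem, hcrb, hrate, _, hmem, hcrb.le, hrate⟩
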